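/- Let $\mathbb{K}$ be an algebraically closed field of arbitrary characteristic and let $n\geq 2$. For $f=\sum_m a_mX^m\in\mathbb{K}[X]$ let $f_i:=\sum_{m\ge i}\binom{m}{i}a_mX^{m-i}$ be its $i$-th Hasse–Schmidt derivative. The Casas-Alvero conjecture in degree $n$ over $\mathbb{K}$ is the assertion that, for every monic $f\in\mathbb{K}[X]$ of degree $n$, $\gcd(f,f_i)$ is non-trivial for each $i=1,\dots,n-1$ if and only if $f=(X-\alpha)^n$ for some $\alpha\in\mathbb{K}$. For a finite set of variables $x_s$ ($s\in S$), let $HD^k$ be the $\mathbb{K}$-linear map on $\mathbb{K}[x_s : s\in S]$ given on monomials by $$HD^k\Big(\prod_s x_s^{a_s}\Big)=\sum_{\sum_s b_s=k}\ \prod_s\binom{a_s}{b_s}x_s^{a_s-b_s}.$$ For $1\le j\le n$ let $\mathfrak{p}^j_n:\mathbb{K}^n\to\{y\in\mathbb{K}^n : y_j=0\}$ be the map $(x_1,\dots,x_n)\mapsto(x_1-x_j,\dots,x_n-x_j)$, and for $k\ge 0$ let $V^j_{n-1}(k)$ be the set of points $y\in\mathbb{K}^n$ with $y_j=0$ at whose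 remaining $n-1$ coordinates the polynomial $HD^{k}\big(\prod_{l\ne j}x_l\big)\in\mathbb{K}[x_l : l\neq j]$ vanishes. For $1\le i\le n-1$ define the $i$-th discriminant hypersurface of degree $n$ to be $$X^i_n(\mathbb{K}):=\bigcup_{j=1}^{n}(\mathfrak{p}^j_n)^{-1}\big(V^j_{n-1}(i-1)\big)\subseteq\mathbb{A}^n(\mathbb{K})=\mathbb{K}^n .$$ Then the Casas-Alvero conjecture in degree $n$ over $\mathbb{K}$ is true if and only if $\bigcap_{i=1}^{n-1}X^i_n(\mathbb{K})$ is an irreducible subset of $\mathbb{K}^n$ in the Zariski topology. -/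

import Mathlib

noncomputable section

namespace CasasAlvero

open MvPolynomial

/-- The Casas-Alvero conjecture in degree `n` over the field `K`: for every monic `f` of degree `n`,
`gcd(f, f_i)` is non-trivial for each `i = 1, …, n - 1` if and only if `f = (X - α)^n` for some `α`.
Here `f_i` is the `i`-th Hasse-Schmidt derivative of `f`. -/
def ConjectureInDegree (K : Type*) [Field K] (n : ℕ) : Prop :=
  ∀ f : Polynomial K, f.Monic → f.natDegree = n →
    ((∀ i : ℕ, 1 ≤ i → i ≤ n - 1 → ¬ IsCoprime f (Polynomial.hasseDeriv i f)) ↔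
      ∃ α : K, f = (Polynomial.X - Polynomial.C α) ^ n)

/-- The `i`-th multivariate Hasse-Schmidt derivation on `K[x_s : s ∈ σ]`: the `K`-linear map with
`x^a ↦ ∑_{|b| = i} (∏_s (a_s choose b_s)) x^(a - b)`. -/
def hasseSchmidt (K : Type*) [Field K] (σ : Type*) [Fintype σ] [DecidableEq σ] (i : ℕ) :
    MvPolynomial σ K →ₗ[K] MvPolynomial σ K :=
  (basisMonomials σ K).constr K fun a : σ →₀ ℕ =>
    ∑ b ∈ Finset.univ.finsuppAntidiag i, monomial (a - b) (∏ s, ((a s).choose (b s) : K))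

/-- The subset of the coordinate hyperplane `x_j = 0` of `K^n` cut out by the `k`-th Hasse-Schmidt
derivation of the product of the `n - 1` variables other than `x_j`. -/
def hyperplaneLocus (K : Type*) [Field K] (n : ℕ) (k : ℕ) (j : Fin n) : Set (Fin n → K) :=
  {y | y j = 0 ∧
    eval (fun l : {l : Fin n // l ≠ j} => y l)
      (hasseSchmidt K {l : Fin n // l ≠ j} k (∏ l : {l : Fin n // l ≠ j}, X l)) = 0}

/-- The `j`-th shift projection `(x_1, …, x_n) ↦ (x_1 - x_j, …, x_n - x_j)`. -/
def shiftProjection {K : Type*} [Field K] {n : ℕ} (j : Fin n) (x : Fin n → K) : Fin n → K :=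
  fun l => x l - x j

/-- The `i`-th discriminant hypersurface `X^i_n(K)` of degree `n` (for `1 ≤ i ≤ n - 1`). -/
def discriminantHypersurface (K : Type*) [Field K] (n i : ℕ) : Set (Fin n → K) :=
  ⋃ j : Fin n, shiftProjection j ⁻¹' hyperplaneLocus K n (i - 1) j

/-- The Zariski topology on `K^n`: the closed sets are the zero loci of ideals of
`K[x_1, …, x_n]`. -/
abbrev zariskiTopology (K : Type*) [Field K] (n : ℕ) : TopologicalSpace (Fin n → K) :=
  TopologicalSpace.ofClosed {Z | ∃ I : Ideal (MvPolynomial (Fin n) K), Z = zeroLocus K I}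
    ⟨⊤, by rw [zeroLocus_top]; rfl⟩
    (by
      intro A hA
      refine ⟨Ideal.span {p | ∃ I : Ideal (MvPolynomial (Fin n) K), zeroLocus K I ∈ A ∧ p ∈ I}, ?_⟩
      rw [zeroLocus_span]
      ext x
      constructor
      · rintro hx p ⟨I, hI, hp⟩
        exact hx _ hI p hp
      · intro hx Z hZ
        obtain ⟨I, rfl⟩ := hA hZ
        exact fun p hp => hx p ⟨I, hZ, hp⟩)
    (by
      rintro _ ⟨I, rfl⟩ _ ⟨J, rfl⟩
      refine ⟨I ⊓ J, ?_⟩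
      ext x
      constructor
      · rintro (hx | hx)
        · exact fun p hp => hx p hp.1
        · exact fun p hp => hx p hp.2
      · intro hx
        by_contra hcon
        rw [Set.mem_union, not_or] at hcon
        simp only [mem_zeroLocus_iff, not_forall] at hcon
        obtain ⟨⟨p, hp, hpx⟩, q, hq, hqx⟩ := hcon
        have h := hx (p * q) ⟨I.mul_mem_right q hp, J.mul_mem_left p hq⟩
        rw [map_mul] at h
        exact (mul_ne_zero hpx hqx) h)

/-- Irreducibility of a subset of `K^n` in the Zariski topology. -/
def ZariskiIrreducible {K : Type*} [Field K] {n : ℕ} (S : Set (Fin n → K)) : Prop :=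
  @IsIrreducible (Fin n → K) (zariskiTopology K n) S

end CasasAlvero

end

/-! View `x` as the root tuple of `f = ∏ (X - x_l)`. Expanding `f` at `x_j` shows that the `j`-th
piece of the `i`-th hypersurface is the locus `f_i(x_j) = 0`, so the intersection consists of the
tuples whose `f` shares a root with every `f_i` (`mem_iInter_discriminantHypersurface_iff`). Under
the conjecture this is the diagonal, an irreducible line. Conversely, an irreducible intersection
lies, for each `i`, in a single closed piece; since it is stable under permuting coordinates, `f_i`
vanishes at every `x_j`. Hence all Taylor coefficients of `f` at one root vanish below degree `n`,
and `f` is a pure power. -/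

open scoped Topology

namespace CasasAlvero

section HasseSchmidt

variable {K : Type*} [Field K] {σ : Type*} [Fintype σ] [DecidableEq σ]

/-- Evaluating the `k`-th Hasse-Schmidt derivation of `p` at `y` gives the coefficient of `T^k` in
`p(y + T)`, where `T` is added to every coordinate. -/
theorem eval_hasseSchmidt (k : ℕ) (y : σ → K) (p : MvPolynomial σ K) :
    MvPolynomial.eval y (hasseSchmidt K σ k p) =
      (MvPolynomial.aeval (fun s => (Polynomial.X + Polynomial.C (y s) : Polynomial K)) p).coeff
        k := by
  have key : (MvPolynomial.aeval y).toLinearMap ∘ₗ hasseSchmidt K σ k =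
      Polynomial.lcoeff K k ∘ₗ (MvPolynomial.aeval
        (fun s => (Polynomial.X + Polynomial.C (y s) : Polynomial K))).toLinearMap := by
    refine (MvPolynomial.basisMonomials σ K).ext fun a => ?_
    rw [LinearMap.comp_apply, hasseSchmidt, Module.Basis.constr_basis]
    simp only [LinearMap.comp_apply, MvPolynomial.coe_basisMonomials, AlgHom.toLinearMap_apply, map_sum, Polynomial.lcoeff_apply,
      MvPolynomial.aeval_monomial, Finsupp.prod_fintype _ _ (fun _ => pow_zero _), map_one, one_mul]
    -- In power series, the coefficient of a finite product is a sum over `finsuppAntidiag`, the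
    -- index set of `hasseSchmidt`.
    rw [← Polynomial.coeff_coe, ← Polynomial.coeToPowerSeries.ringHom_apply, map_prod,
      PowerSeries.coeff_prod]
    refine Finset.sum_congr rfl fun b _ => ?_
    simp only [Polynomial.coeToPowerSeries.ringHom_apply, Polynomial.coeff_coe,
      Polynomial.coeff_X_add_C_pow, Algebra.algebraMap_self, RingHom.id_apply, Finsupp.coe_tsub,
      Pi.sub_apply]
    rw [← Finset.prod_mul_distrib]
    exact Finset.prod_congr rfl fun s _ => mul_comm _ _
  have h := LinearMap.congr_fun key p
  simpa [MvPolynomial.aeval_eq_eval] using h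

theorem eval_hasseSchmidt_prod_X (k : ℕ) (y : σ → K) :
    MvPolynomial.eval y (hasseSchmidt K σ k (∏ s, MvPolynomial.X s)) =
      (∏ s, (Polynomial.X + Polynomial.C (y s))).coeff k := by
  simp [eval_hasseSchmidt]

end HasseSchmidt

section Polynomial

open Polynomial

variable {K : Type*} [Field K] {n : ℕ}

/-- The monic polynomial with roots `x_1, …, x_n`. -/
noncomputable def rootPolynomial (x : Fin n → K) : K[X] := ∏ l, (X - C (x l))

theorem rootPolynomial_monic (x : Fin n → K) : (rootPolynomial x).Monic :=
  monic_prod_of_monic _ _ fun l _ => monic_X_sub_C (x l)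

theorem natDegree_rootPolynomial (x : Fin n → K) : (rootPolynomial x).natDegree = n := by
  simp [rootPolynomial]

theorem rootPolynomial_comp_perm (x : Fin n → K) (e : Equiv.Perm (Fin n)) :
    rootPolynomial (x ∘ e) = rootPolynomial x :=
  Equiv.prod_comp e fun l => X - C (x l)

theorem eval_rootPolynomial_eq_zero_iff (x : Fin n → K) (a : K) :
    (rootPolynomial x).eval a = 0 ↔ ∃ j, x j = a := by
  rw [rootPolynomial, eval_prod, Finset.prod_eq_zero_iff]
  simp [sub_eq_zero, eq_comm]

theorem rootPolynomial_const (a : K) : rootPolynomial (fun _ : Fin n => a) = (X - C a) ^ n := by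
  simp [rootPolynomial]

theorem exists_rootPolynomial_eq [IsAlgClosed K] {f : K[X]} (hf : f.Monic)
    (hn : f.natDegree = n) : ∃ x : Fin n → K, rootPolynomial x = f := by
  have hs := IsAlgClosed.splits f
  have hlen : f.roots.toList.length = n := by
    rw [Multiset.length_toList, ← hs.natDegree_eq_card_roots, hn]
  subst hlen
  refine ⟨fun l => f.roots.toList.get l, ?_⟩
  conv_rhs => rw [hs.eq_prod_roots_of_monic hf, ← Multiset.coe_toList f.roots, Multiset.map_coe,
    Multiset.prod_coe]
  rw [rootPolynomial, ← List.prod_ofFn]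
  congr 1
  rw [← Function.comp_def (fun a => X - C a), ← List.map_ofFn, List.ofFn_get]

/-- Substituting `-X` changes coefficients only by signs. This reconciles the `T + y` of
`eval_hasseSchmidt` with the linear factors of `f`. -/
theorem coeff_prod_X_sub_C_eq_zero_iff {ι : Type*} [Fintype ι] (y : ι → K) (k : ℕ) :
    (∏ l, (X - C (y l))).coeff k = 0 ↔ (∏ l, (X + C (y l))).coeff k = 0 := by
  have h : (∏ l, (X + C (y l))).comp (C (-1) * X) =
      C ((-1) ^ Fintype.card ι) * ∏ l, (X - C (y l)) := by
    rw [prod_comp, C_pow, ← Finset.card_univ, ← Finset.prod_const, ← Finset.prod_mul_distrib]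
    refine Finset.prod_congr rfl fun l _ => ?_
    simp
    ring
  have hc := congrArg (coeff · k) h
  simp only [coeff_C_mul, comp_C_mul_X_coeff] at hc
  constructor
  · intro h0
    simpa [h0] using hc
  · intro h0
    simpa [h0] using hc.symm

/-- The factor at `l = j` becomes `X`; it accounts for the shift from `i` to `i - 1`. -/
theorem taylor_rootPolynomial (x : Fin n → K) (j : Fin n) :
    taylor (x j) (rootPolynomial x) = X * ∏ l : {l : Fin n // l ≠ j}, (X - C (x l - x j)) := by
  have h : taylor (x j) (rootPolynomial x) = ∏ l, (X - C (x l - x j)) := by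
    rw [rootPolynomial, ← taylorAlgHom_apply, map_prod]
    refine Finset.prod_congr rfl fun l _ => ?_
    simp
    ring
  rw [h, Fintype.prod_eq_mul_prod_subtype_ne _ j]
  simp

theorem shiftProjection_mem_hyperplaneLocus_iff (k : ℕ) (j : Fin n) (x : Fin n → K) :
    shiftProjection j x ∈ hyperplaneLocus K n k j ↔
      (hasseDeriv (k + 1) (rootPolynomial x)).eval (x j) = 0 := by
  rw [← taylor_coeff, taylor_rootPolynomial, coeff_X_mul, coeff_prod_X_sub_C_eq_zero_iff,
    ← eval_hasseSchmidt_prod_X]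
  simp [hyperplaneLocus, shiftProjection]

theorem mem_discriminantHypersurface_iff {i : ℕ} (hi : 1 ≤ i) (x : Fin n → K) :
    x ∈ discriminantHypersurface K n i ↔
      ∃ j, (hasseDeriv i (rootPolynomial x)).eval (x j) = 0 := by
  simp only [discriminantHypersurface, Set.mem_iUnion, Set.mem_preimage,
    shiftProjection_mem_hyperplaneLocus_iff, Nat.sub_add_cancel hi]

theorem not_isCoprime_iff_exists_eval_eq_zero [IsAlgClosed K] (f g : K[X]) :
    ¬ IsCoprime f g ↔ ∃ a, f.eval a = 0 ∧ g.eval a = 0 := by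
  rw [isCoprime_iff_aeval_ne_zero_of_isAlgClosed (k := K) K]
  simp [coe_aeval_eq_eval]

theorem mem_discriminantHypersurface_iff_not_isCoprime [IsAlgClosed K] {i : ℕ} (hi : 1 ≤ i)
    (x : Fin n → K) :
    x ∈ discriminantHypersurface K n i ↔
      ¬ IsCoprime (rootPolynomial x) (hasseDeriv i (rootPolynomial x)) := by
  rw [mem_discriminantHypersurface_iff hi, not_isCoprime_iff_exists_eval_eq_zero]
  simp [eval_rootPolynomial_eq_zero_iff]

theorem eval_hasseDeriv_X_sub_C_pow (a : K) {i : ℕ} (hi : i < n) :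
    (hasseDeriv i ((X - C a) ^ n)).eval a = 0 := by
  rw [← taylor_coeff, taylor_pow]
  simp [coeff_X_pow, hi.ne]

/-- Values of Hasse derivatives at `a` are exactly the Taylor coefficients there, with no
factorials, so the characteristic plays no role. -/
theorem eq_X_sub_C_pow_of_eval_hasseDeriv {f : K[X]} (hf : f.Monic) (hn : f.natDegree = n) {a : K}
    (h : ∀ i < n, (hasseDeriv i f).eval a = 0) : f = (X - C a) ^ n := by
  refine taylor_injective a ?_
  rw [taylor_pow]
  ext i
  have hX : taylor a (X - C a) = X := by simp
  rw [hX, coeff_X_pow]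
  rcases lt_trichotomy i n with hi | rfl | hi
  · rw [taylor_coeff, h i hi, if_neg hi.ne]
  · rw [if_pos rfl, ← hn, coeff_taylor_natDegree, hf.leadingCoeff]
  · rw [if_neg hi.ne', coeff_eq_zero_of_natDegree_lt (by rwa [natDegree_taylor, hn])]

end Polynomial

section Zariski

variable {K : Type*} [Field K] {n : ℕ}

theorem isClosed_zariskiTopology_iff {Z : Set (Fin n → K)} :
    IsClosed[zariskiTopology K n] Z ↔
      ∃ I : Ideal (MvPolynomial (Fin n) K), Z = MvPolynomial.zeroLocus K I := by
  rw [← @isOpen_compl_iff _ _ (zariskiTopology K n)]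
  change Zᶜᶜ ∈ {Z | ∃ I : Ideal (MvPolynomial (Fin n) K), Z = MvPolynomial.zeroLocus K I} ↔ _
  rw [compl_compl, Set.mem_ofPred_eq]

/-- One equation suffices, because the shifted point has `j`-th coordinate zero automatically. -/
theorem isClosed_shiftProjection_preimage (k : ℕ) (j : Fin n) :
    IsClosed[zariskiTopology K n] (shiftProjection j ⁻¹' hyperplaneLocus K n k j) := by
  rw [isClosed_zariskiTopology_iff]
  refine ⟨Ideal.span {MvPolynomial.aeval
    (fun l : {l : Fin n // l ≠ j} =>
      (MvPolynomial.X (l : Fin n) - MvPolynomial.X j : MvPolynomial (Fin n) K))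
    (hasseSchmidt K {l : Fin n // l ≠ j} k (∏ l : {l : Fin n // l ≠ j}, MvPolynomial.X l))}, ?_⟩
  ext x
  rw [MvPolynomial.zeroLocus_span]
  simp only [Set.mem_preimage, hyperplaneLocus, shiftProjection, Set.mem_ofPred_eq, sub_self,
    true_and, Set.mem_singleton_iff, forall_eq, MvPolynomial.comp_aeval_apply, map_sub,
    MvPolynomial.aeval_X]
  rw [MvPolynomial.aeval_eq_eval]

/-- On the diagonal, polynomials become univariate, and `K[X]` is a domain whose nonzero elements
cannot vanish on all of the infinite field `K`. -/
theorem zariskiIrreducible_range_const [Infinite K] :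
    ZariskiIrreducible (Set.range fun (a : K) (_ : Fin n) => a) := by
  refine ⟨Set.range_nonempty _, ?_⟩
  rw [@isPreirreducible_iff_isClosed_union_isClosed]
  intro Z₁ Z₂ h₁ h₂ hsub
  obtain ⟨I, rfl⟩ := isClosed_zariskiTopology_iff.1 h₁
  obtain ⟨J, rfl⟩ := isClosed_zariskiTopology_iff.1 h₂
  have heval (p : MvPolynomial (Fin n) K) (a : K) :
      MvPolynomial.aeval (fun _ => a) p =
        (MvPolynomial.aeval (fun _ => (Polynomial.X : Polynomial K)) p).eval a := by
    rw [← Polynomial.coe_aeval_eq_eval, MvPolynomial.comp_aeval_apply]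
    simp
  by_contra! hcon
  simp only [Set.not_subset, Set.exists_range_iff, MvPolynomial.mem_zeroLocus_iff, not_forall]
    at hcon
  obtain ⟨⟨a, p, hp, hpa⟩, b, q, hq, hqb⟩ := hcon
  rw [heval] at hpa hqb
  have hne := mul_ne_zero
    (ne_of_apply_ne (Polynomial.eval a) (hpa.imp (·.trans Polynomial.eval_zero)))
    (ne_of_apply_ne (Polynomial.eval b) (hqb.imp (·.trans Polynomial.eval_zero)))
  refine hne (Polynomial.funext fun c => ?_)
  rw [Polynomial.eval_mul, Polynomial.eval_zero, ← heval, ← heval]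
  rcases hsub ⟨c, rfl⟩ with h | h
  · rw [h p hp, zero_mul]
  · rw [h q hq, mul_zero]

theorem ZariskiIrreducible.exists_subset_of_subset_iUnion {ι : Type*} [Finite ι]
    {S : Set (Fin n → K)} (hS : ZariskiIrreducible S) {Z : ι → Set (Fin n → K)}
    (hZ : ∀ j, IsClosed[zariskiTopology K n] (Z j)) (hsub : S ⊆ ⋃ j, Z j) : ∃ j, S ⊆ Z j := by
  have hfin := Set.finite_range Z
  obtain ⟨_, hz, hSz⟩ := (@isIrreducible_iff_sUnion_isClosed _ (zariskiTopology K n) S).1 hS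
    hfin.toFinset (by simpa using hZ) (by simpa using hsub)
  obtain ⟨j, rfl⟩ := hfin.mem_toFinset.1 hz
  exact ⟨j, hSz⟩

end Zariski

section Main

variable {K : Type*} [Field K] {n : ℕ}

theorem mem_iInter_discriminantHypersurface_iff [IsAlgClosed K] (x : Fin n → K) :
    x ∈ ⋂ i ∈ Finset.Icc 1 (n - 1), discriminantHypersurface K n i ↔
      ∀ i : ℕ, 1 ≤ i → i ≤ n - 1 →
        ¬ IsCoprime (rootPolynomial x) (Polynomial.hasseDeriv i (rootPolynomial x)) := by
  simp only [Set.mem_iInter, Finset.mem_Icc, and_imp]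
  exact forall₃_congr fun i hi _ => mem_discriminantHypersurface_iff_not_isCoprime hi x

theorem not_isCoprime_hasseDeriv_X_sub_C_pow [IsAlgClosed K] (a : K) {i : ℕ} (hi : i < n) :
    ¬ IsCoprime ((Polynomial.X - Polynomial.C a) ^ n)
      (Polynomial.hasseDeriv i ((Polynomial.X - Polynomial.C a) ^ n)) := by
  rw [not_isCoprime_iff_exists_eval_eq_zero]
  exact ⟨a, by simp [(Nat.zero_le i).trans_lt hi |>.ne'], eval_hasseDeriv_X_sub_C_pow a hi⟩

theorem ConjectureInDegree.iInter_discriminantHypersurface_eq [IsAlgClosed K]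
    (h : ConjectureInDegree K n) :
    ⋂ i ∈ Finset.Icc 1 (n - 1), discriminantHypersurface K n i =
      Set.range fun (a : K) (_ : Fin n) => a := by
  ext x
  rw [mem_iInter_discriminantHypersurface_iff,
    h _ (rootPolynomial_monic x) (natDegree_rootPolynomial x)]
  constructor
  · rintro ⟨a, ha⟩
    refine ⟨a, funext fun l => ?_⟩
    have hl := (eval_rootPolynomial_eq_zero_iff x (x l)).2 ⟨l, rfl⟩
    rw [ha] at hl
    have hl' : x l - a = 0 := eq_zero_of_pow_eq_zero (by simpa using hl)
    exact (sub_eq_zero.1 hl').symm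
  · rintro ⟨a, rfl⟩
    exact ⟨a, rootPolynomial_const a⟩

/-- If the intersection of the discriminant hypersurfaces is irreducible, then by invariance under
permutations of the coordinates every coordinate of each of its points is a common root of all
Hasse-Schmidt derivatives. -/
theorem eval_hasseDeriv_eq_zero_of_zariskiIrreducible [IsAlgClosed K]
    (hV : ZariskiIrreducible
      (⋂ i ∈ Finset.Icc 1 (n - 1), discriminantHypersurface K n i))
    {x : Fin n → K} (hx : x ∈ ⋂ i ∈ Finset.Icc 1 (n - 1), discriminantHypersurface K n i)
    {i : ℕ} (hi : 1 ≤ i) (hin : i ≤ n - 1) (j : Fin n) :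
    (Polynomial.hasseDeriv i (rootPolynomial x)).eval (x j) = 0 := by
  obtain ⟨m, hm⟩ := ZariskiIrreducible.exists_subset_of_subset_iUnion hV
    (fun j => isClosed_shiftProjection_preimage (i - 1) j)
    (Set.biInter_subset_of_mem (Finset.mem_Icc.2 ⟨hi, hin⟩))
  -- The index `m` may depend on `i`; the swap puts `x j` in position `m` without changing the
  -- polynomial.
  have hmem : x ∘ Equiv.swap j m ∈
      ⋂ i ∈ Finset.Icc 1 (n - 1), discriminantHypersurface K n i := by
    rw [mem_iInter_discriminantHypersurface_iff] at hx ⊢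
    rwa [rootPolynomial_comp_perm]
  have h := (shiftProjection_mem_hyperplaneLocus_iff _ _ _).1 (hm hmem)
  rwa [Nat.sub_add_cancel hi, rootPolynomial_comp_perm, Function.comp_apply,
    Equiv.swap_apply_right] at h

theorem conjectureInDegree_of_zariskiIrreducible [IsAlgClosed K] (hn : 2 ≤ n)
    (hV : ZariskiIrreducible
      (⋂ i ∈ Finset.Icc 1 (n - 1), discriminantHypersurface K n i)) :
    ConjectureInDegree K n := by
  intro f hf hfn
  constructor
  · obtain ⟨x, rfl⟩ := exists_rootPolynomial_eq hf hfn
    intro h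
    let j : Fin n := ⟨0, by omega⟩
    refine ⟨x j, eq_X_sub_C_pow_of_eval_hasseDeriv hf hfn fun i hi => ?_⟩
    -- Order zero is not covered by the hypersurfaces; there the claim is that `x j` is a root.
    rcases Nat.eq_zero_or_pos i with rfl | hi0
    · rw [Polynomial.hasseDeriv_zero']
      exact (eval_rootPolynomial_eq_zero_iff x _).2 ⟨j, rfl⟩
    · exact eval_hasseDeriv_eq_zero_of_zariskiIrreducible hV
        ((mem_iInter_discriminantHypersurface_iff x).2 h) hi0 (by omega) j
  · rintro ⟨a, rfl⟩ i _ hin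
    exact not_isCoprime_hasseDeriv_X_sub_C_pow a (by omega)

end Main

end CasasAlvero

theorem corollary4p10 (K : Type*) [Field K] [IsAlgClosed K] (n : ℕ) (hn : 2 ≤ n) :
    CasasAlvero.ConjectureInDegree K n ↔
      CasasAlvero.ZariskiIrreducible
        (⋂ i ∈ Finset.Icc 1 (n - 1), CasasAlvero.discriminantHypersurface K n i) := by
  refine ⟨fun h => ?_, CasasAlvero.conjectureInDegree_of_zariskiIrreducible hn⟩
  have : Infinite K := IsAlgClosed.instInfinite
  rw [h.iInter_discriminantHypersurface_eq]
  exact CasasAlvero.zariskiIrreducible_range_const
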